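/- Let $X$ be a real Banach space (that is, a set $X$ together with a real Banach space structure on it), and suppose that either $X$ has a fundamental minimal system, i.e. there is a family $\{x_i\}_{i\in I}$ of vectors of $X$ whose closed linear hull is $X$ and such that, for every $i\in I$, $x_i$ does not belong to the closed linear hull of $\{x_j : j\in I,\ j\neq i\}$; or the density $\operatorname{dens} X$ (the least cardinality of a dense subset of $X$) equals $\aleph_1$. Then suitable models generate nice rich families in $X$, that is: whenever $Y$ is a countable set and $\varphi_1,\dots,\varphi_n$ is a finite list of formulas in the language of set theory, there exists a set $\mathcal M$ such that, writing $X_M := \overline{X\cap M}$ (closure in $X$), (i) every $M\in\mathcal M$ is a suitable model for $\varphi_1,\dots,\varphi_n$ containing $Y$, i.e. $M\supset Y$ is a countable set for which each formula $\varphi=\varphi_k$ is absolute: $\varphi^M(a_1,\dots,a_l)\leftrightarrow\varphi(a_1,\dots,a_l)$ for all $a_1,\dots,a_l\in M$, where $a_1,\dots,a_l$ are values for the free variables of $\varphi$ and $\varphi^M$ is obtained from $\varphi$ by restricting all quantifiers to $M$; (ii) $\{X_M : M\in\mathcal M\}$ is a rich family of separable subspaces of $X$, i.e. every $X_M$ with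 $M\in\mathcal M$ is a closed separable linear subspace of $X$, every separable subspace of $X$ is contained in some $X_M$ with $M\in\mathcal M$, and for every increasing sequence $F_1\subset F_2\subset\cdots$ of members of the family the closure $\overline{\bigcup_{i} F_i}$ is a member of the family; (iii) for all $M,N\in\mathcal M$: $M\subset N$ if and only if $X_M\subset X_N$. Countable means finite or countably infinite. -/

import Mathlib

/-! Formulas of set theory are the first-order formulas of Mathlib over a language with one binary
relation symbol, interpreted in the universe of sets `ZFSet` by membership. -/

universe u v

namespace SetModels

/-- The relation symbols of the language of set theory: one binary symbol. -/
inductive MemRel : ℕ → Type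
  | mem : MemRel 2

/-- The language of set theory (equality is a logical symbol). -/
def setLang : FirstOrder.Language := ⟨fun _ => Empty, MemRel⟩

/-- The universe of all sets: the symbol `mem` is interpreted by the membership relation. -/
instance : setLang.Structure ZFSet.{u} where
  funMap f _ := Empty.elim f
  RelMap {_} R := match R with
    | .mem => fun x => x 0 ∈ x 1

/-- `RealizeRel N φ v xs` says that the relativization `φ^N` holds under the given assignment of
the free variables (`v`) and of the variables bound further outside (`xs`): all quantifiers range
over the elements of the set `N` (`∃` is an abbreviation of `¬∀¬`). -/
def RealizeRel (N : ZFSet.{u}) {α : Type*} :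
    ∀ {n : ℕ}, setLang.BoundedFormula α n → (α → ZFSet.{u}) → (Fin n → ZFSet.{u}) → Prop
  | _, .falsum, _, _ => False
  | _, .equal t₁ t₂, v, xs => t₁.realize (Sum.elim v xs) = t₂.realize (Sum.elim v xs)
  | _, .rel R ts, v, xs =>
      FirstOrder.Language.Structure.RelMap R fun i => (ts i).realize (Sum.elim v xs)
  | _, .imp f₁ f₂, v, xs => RealizeRel N f₁ v xs → RealizeRel N f₂ v xs
  | _, .all f, v, xs => ∀ x ∈ N, RealizeRel N f v (Fin.snoc xs x)

/-- `φ` is absolute for `N`: `φ^N(a₁, …, aₙ) ↔ φ(a₁, …, aₙ)` whenever the values `a₁, …, aₙ` of the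
free variables that occur in `φ` are elements of `N`. -/
def IsAbsolute (N : ZFSet.{u}) (φ : setLang.Formula ℕ) : Prop :=
  ∀ a : ℕ → ZFSet.{u}, (∀ i ∈ FirstOrder.Language.BoundedFormula.freeVarFinset φ, a i ∈ N) →
    (RealizeRel N φ a default ↔ φ.Realize a)

/-- `M ≺ (φ₁, …, φₙ; Y)`: the set `M` is a suitable model for the formulas in the list `Φ`
containing `Y`. -/
structure IsSuitableModel (M : ZFSet.{u}) (Φ : List (setLang.Formula ℕ)) (Y : ZFSet.{u}) :
    Prop where
  subset : Y ⊆ M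
  countable : (M : Set ZFSet.{u}).Countable
  isAbsolute : ∀ φ ∈ Φ, IsAbsolute M φ

/-- A rich family of (closed) separable subspaces of `X`. -/
structure IsRichFamily {X : Type*} [NormedAddCommGroup X] [NormedSpace ℝ X]
    (F : Set (Set X)) : Prop where
  isSubspace : ∀ S ∈ F, ∃ W : Submodule ℝ X, (W : Set X) = S
  isClosed : ∀ S ∈ F, IsClosed S
  isSeparable : ∀ S ∈ F, TopologicalSpace.IsSeparable S
  exists_superset : ∀ W : Submodule ℝ X, TopologicalSpace.IsSeparable (W : Set X) →
    ∃ S ∈ F, (W : Set X) ⊆ S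
  closure_iUnion_mem : ∀ S : ℕ → Set X, (∀ n, S n ∈ F) → Monotone S → closure (⋃ n, S n) ∈ F

/-- For a set `X` with a topology, `X_M` is the closure in `X` of `X ∩ M`. -/
def closureInter (X : ZFSet.{u}) [TopologicalSpace X] (M : ZFSet.{u}) : Set X :=
  closure {x : X | (x : ZFSet.{u}) ∈ M}

/-- Suitable models generate nice rich families in the Banach space whose set of points is the
set `X`. -/
def SuitableModelsGenerateNiceRichFamilies (X : ZFSet.{u}) [NormedAddCommGroup X]
    [NormedSpace ℝ X] : Prop :=
  ∀ (Y : ZFSet.{u}) (Φ : List (setLang.Formula ℕ)), (Y : Set ZFSet.{u}).Countable →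
    ∃ 𝓜 : ZFSet.{u},
      (∀ M ∈ 𝓜, IsSuitableModel M Φ Y) ∧
      IsRichFamily {S : Set X | ∃ M ∈ 𝓜, closureInter X M = S} ∧
      ∀ M ∈ 𝓜, ∀ N ∈ 𝓜, (M ⊆ N ↔ closureInter X M ⊆ closureInter X N)

/-- A fundamental minimal system: the closed linear hull of the family is `X`, and no `x i` is in
the closed linear hull of the other members. -/
structure IsFundamentalMinimalSystem {X : Type*} [NormedAddCommGroup X] [NormedSpace ℝ X]
    {ι : Type*} (x : ι → X) : Prop where
  fundamental : (Submodule.span ℝ (Set.range x)).topologicalClosure = ⊤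
  minimal : ∀ i, x i ∉ (Submodule.span ℝ (x '' {j | j ≠ i})).topologicalClosure

/-- The density `dens X`: the least cardinality of a dense subset. -/
noncomputable def dens (X : Type*) [TopologicalSpace X] : Cardinal :=
  sInf {κ | ∃ D : Set X, Dense D ∧ Cardinal.mk D = κ}

end SetModels

/-! Models are hulls `H A` of sets of vectors under one finitary operation with countable values,
which adds `Y`, Skolem witnesses, supports and countable sets whose closures contain the spans. Such
hulls are countable and elementary, and they commute with increasing unions (`hull_iUnion`). Both
hypotheses on the space yield a support system: a set `I` in which support-closed subsets can be
recovered, monotonically, from their closed spans. Only countable `A ⊆ I` with `trace I (H A) = A`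
are kept. Then the space of the model is the closed span of `A` (`IsAdapted.closure_eq`), so it
determines `A` and hence the model, monotonically. -/

open Set Submodule TopologicalSpace

namespace SetModels

/-! ### Hulls under finitary operations -/

section Hull

variable {α : Type*}

/-- A set is closed under a finitary set-valued operation. -/
def IsClosedUnder (G : Finset α → Set α) (M : Set α) : Prop :=
  ∀ s : Finset α, (s : Set α) ⊆ M → G s ⊆ M

/-- The least set containing `A` that is closed under the operation `G`. -/
def hull (G : Finset α → Set α) (A : Set α) : Set α :=
  ⋂₀ {M | A ⊆ M ∧ IsClosedUnder G M}

theorem subset_hull (G : Finset α → Set α) (A : Set α) : A ⊆ hull G A :=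
  subset_sInter fun _ hM => hM.1

theorem hull_subset {G : Finset α → Set α} {A M : Set α} (h : A ⊆ M) (hM : IsClosedUnder G M) :
    hull G A ⊆ M :=
  sInter_subset_of_mem ⟨h, hM⟩

theorem isClosedUnder_hull (G : Finset α → Set α) (A : Set α) : IsClosedUnder G (hull G A) :=
  fun s hs => subset_sInter fun _ hM => hM.2 s (hs.trans (sInter_subset_of_mem hM))

theorem hull_mono {G : Finset α → Set α} {A B : Set α} (h : A ⊆ B) : hull G A ⊆ hull G B :=
  hull_subset (h.trans (subset_hull G B)) (isClosedUnder_hull G B)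

theorem IsClosedUnder.iUnion {G : Finset α → Set α} {M : ℕ → Set α} (hM : Monotone M)
    (h : ∀ n, IsClosedUnder G (M n)) : IsClosedUnder G (⋃ n, M n) := by
  intro s hs
  obtain ⟨n, hn⟩ : ∃ n, (s : Set α) ⊆ M n :=
    hM.directed_le.exists_mem_subset_of_finset_subset_biUnion hs
  exact (h n s hn).trans (subset_iUnion M n)

/-- Finitarity is decisive: a finite subset of an increasing union already lies in one stage. -/
theorem hull_iUnion {G : Finset α → Set α} {A : ℕ → Set α} (hA : Monotone A) :
    hull G (⋃ n, A n) = ⋃ n, hull G (A n) := by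
  refine Subset.antisymm (hull_subset (iUnion_mono fun n => subset_hull G (A n)) ?_)
    (iUnion_subset fun n => hull_mono (subset_iUnion A n))
  exact .iUnion (fun _ _ h => hull_mono (hA h)) fun n => isClosedUnder_hull G (A n)

theorem countable_hull {G : Finset α → Set α} (hG : ∀ s, (G s).Countable) {A : Set α}
    (hA : A.Countable) : (hull G A).Countable := by
  let F : Set α → Set α := fun B => B ∪ ⋃ s ∈ {s : Finset α | (s : Set α) ⊆ B}, G s
  have hfin {B : Set α} (hB : B.Countable) : {s : Finset α | (s : Set α) ⊆ B}.Countable :=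
    ((countable_ofPred_finite_subset hB).preimage Finset.coe_injective).mono
      fun s hs => And.intro s.finite_toSet hs
  have hF : ∀ B, B.Countable → (F B).Countable := fun B hB =>
    hB.union ((hfin hB).biUnion fun s _ => hG s)
  have hmono : Monotone fun n => F^[n] A := monotone_nat_of_le_succ fun n => by
    rw [Function.iterate_succ_apply']
    exact subset_union_left
  refine (countable_iUnion (t := fun n => F^[n] A) fun n => ?_).mono (hull_subset ?_ ?_)
  · induction n with
    | zero => exact hA
    | succ n ih => simpa only [Function.iterate_succ_apply'] using hF _ ih
  · exact subset_iUnion (fun n => F^[n] A) 0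
  · intro s hs
    obtain ⟨n, hn⟩ : ∃ n, (s : Set α) ⊆ F^[n] A :=
      hmono.directed_le.exists_mem_subset_of_finset_subset_biUnion hs
    refine Subset.trans ?_ (subset_iUnion (fun n => F^[n] A) (n + 1))
    simp only [Function.iterate_succ_apply']
    exact subset_union_of_subset_right (subset_biUnion_of_mem (u := fun s => G s) hn) _

end Hull

/-! ### Skolem witnesses and absoluteness -/

section Skolem

open FirstOrder.Language

instance : Countable setLang.Symbols := by
  have (n : ℕ) : Countable (setLang.Functions n) := inferInstanceAs (Countable Empty)
  have (n : ℕ) : Countable (setLang.Relations n) := by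
    refine Function.Injective.countable (f := fun _ : MemRel n => ()) ?_
    rintro ⟨⟩ ⟨⟩ _
    rfl
  exact inferInstanceAs (Countable ((Σ n, setLang.Functions n) ⊕ Σ n, setLang.Relations n))

instance (n : ℕ) : Countable (setLang.BoundedFormula ℕ n) :=
  Function.Injective.countable (f := fun φ => (⟨n, φ⟩ : Σ n, setLang.BoundedFormula ℕ n))
    sigma_mk_injective

/-- A counterexample to `∀ x, φ` under the given assignment, if there is one. -/
noncomputable def counterexample {n : ℕ} (φ : setLang.BoundedFormula ℕ (n + 1))
    (t : φ.freeVarFinset → ZFSet.{u}) (xs : Fin n → ZFSet.{u}) : ZFSet.{u} :=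
  Classical.epsilon fun x => ¬ (φ.restrictFreeVar id).Realize t (Fin.snoc xs x)

/-- All counterexamples for assignments with values in `s`. -/
def skolemValues (s : Finset ZFSet.{u}) : Set ZFSet.{u} :=
  range fun p : Σ q : (Σ n, setLang.BoundedFormula ℕ (n + 1)),
      (q.2.freeVarFinset → s) × (Fin q.1 → s) =>
    counterexample p.1.2 (fun i => p.2.1 i) (fun j => p.2.2 j)

theorem countable_skolemValues (s : Finset ZFSet.{u}) : (skolemValues s).Countable :=
  countable_range _

/-- The Tarski–Vaught test, by induction on the formula; only the quantifier case uses `hN`. -/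
theorem realizeRel_iff_realize {N : ZFSet.{u}}
    (hN : ∀ s : Finset ZFSet.{u}, (s : Set ZFSet.{u}) ⊆ N → skolemValues s ⊆ N) {n : ℕ}
    (φ : setLang.BoundedFormula ℕ n) (a : ℕ → ZFSet.{u}) (ha : ∀ i ∈ φ.freeVarFinset, a i ∈ N)
    (xs : Fin n → ZFSet.{u}) (hxs : ∀ j, xs j ∈ N) :
    RealizeRel N φ a xs ↔ φ.Realize a xs := by
  classical
  induction φ with
  | falsum => rfl
  | equal => rfl
  | rel => rfl
  | imp f g ihf ihg =>
    simp only [BoundedFormula.freeVarFinset, Finset.mem_union] at ha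
    exact imp_congr (ihf (fun i hi => ha i (.inl hi)) xs hxs) (ihg (fun i hi => ha i (.inr hi)) xs hxs)
  | @all n f ih =>
    have hsnoc : ∀ x ∈ N, ∀ j, (Fin.snoc xs x : Fin (n + 1) → ZFSet.{u}) j ∈ N := by
      intro x hx j
      refine Fin.lastCases ?_ (fun j => ?_) j
      · simpa using hx
      · simpa using hxs j
    have key : RealizeRel N f.all a xs ↔ ∀ x ∈ N, f.Realize a (Fin.snoc xs x) :=
      forall₂_congr fun x hx => ih ha _ (hsnoc x hx)
    rw [key, BoundedFormula.realize_all]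
    refine ⟨fun h => ?_, fun h x _ => h x⟩
    by_contra! hcon
    -- Restricting to the variables that occur leaves finitely many parameters, all in `N`, so the
    -- chosen counterexample is a Skolem value.
    let t : f.freeVarFinset → ZFSet.{u} := fun i => a i
    have hiff : ∀ x, (f.restrictFreeVar id).Realize t (Fin.snoc xs x) ↔
        f.Realize a (Fin.snoc xs x) :=
      fun x => BoundedFormula.realize_restrictFreeVar a fun _ => rfl
    obtain ⟨x, hx⟩ := hcon
    have hc : ¬ (f.restrictFreeVar id).Realize t (Fin.snoc xs (counterexample f t xs)) :=
      Classical.epsilon_spec (p := fun x => ¬ (f.restrictFreeVar id).Realize t (Fin.snoc xs x))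
        ⟨x, mt (hiff x).1 hx⟩
    refine hc ((hiff _).2 (h _ ?_))
    let s : Finset ZFSet.{u} := f.freeVarFinset.image a ∪ Finset.univ.image xs
    refine hN s ?_ ⟨⟨⟨n, f⟩, fun i => ⟨a i, ?_⟩, fun j => ⟨xs j, ?_⟩⟩, rfl⟩
    · intro y hy
      simp only [s, Finset.coe_union, Finset.coe_image, Finset.coe_univ, image_univ] at hy
      rcases hy with ⟨i, hi, rfl⟩ | ⟨j, rfl⟩
      · exact ha i hi
      · exact hxs j
    · exact Finset.mem_union_left _ (Finset.mem_image_of_mem a i.2)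
    · exact Finset.mem_union_right _ (Finset.mem_image_of_mem xs (Finset.mem_univ j))

end Skolem

/-! ### Support systems from the two hypotheses -/

section Support

variable {E : Type*} [NormedAddCommGroup E] [NormedSpace ℝ E]

theorem exists_countable_mem_topologicalClosure_span {I : Set E} {x : E}
    (hx : x ∈ (span ℝ I).topologicalClosure) :
    ∃ S ⊆ I, S.Countable ∧ x ∈ (span ℝ S).topologicalClosure := by
  obtain ⟨y, hy, hlim⟩ := mem_closure_iff_seq_limit.1 hx
  choose T hT hyT using fun n => mem_span_finite_of_mem_span (hy n)
  refine ⟨⋃ n, (T n : Set E), iUnion_subset hT, countable_iUnion fun n => (T n).countable_toSet,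
    mem_closure_of_tendsto hlim (.of_forall fun n => ?_)⟩
  exact span_mono (subset_iUnion (fun n => (T n : Set E)) n) (hyT n)

/-- Every vector of `E` has a countable support `q x ∩ I` such that every set in `I` which is closed
under supports is determined, monotonically, by its closed linear hull. -/
structure IsSupportSystem (I : Set E) (q : E → Set E) : Prop where
  countable : ∀ x, (q x).Countable
  mem : ∀ x, x ∈ (span ℝ (q x ∩ I)).topologicalClosure
  subset_of_le : ∀ A ⊆ I, ∀ B ⊆ I, (∀ x ∈ A, q x ∩ I ⊆ A) → (∀ x ∈ B, q x ∩ I ⊆ B) →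
    (span ℝ A).topologicalClosure ≤ (span ℝ B).topologicalClosure → A ⊆ B

theorem IsFundamentalMinimalSystem.exists_isSupportSystem {ι : Type*} {x : ι → E}
    (hx : IsFundamentalMinimalSystem x) : ∃ I q, IsSupportSystem (E := E) I q := by
  have h (y : E) : y ∈ (span ℝ (range x)).topologicalClosure := hx.fundamental ▸ mem_top
  choose q hqI hqc hq using fun y => exists_countable_mem_topologicalClosure_span (h y)
  refine ⟨range x, q, hqc, fun y => ?_, fun A hA B hB _ _ hAB y hy => ?_⟩
  · rw [inter_eq_left.2 (hqI y)]
    exact hq y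
  · obtain ⟨i, rfl⟩ := hA hy
    by_contra hi
    refine hx.minimal i (topologicalClosure_mono (span_mono fun z hz => ?_)
      (hAB (le_topologicalClosure _ (subset_span hy))))
    obtain ⟨j, rfl⟩ := hB hz
    exact ⟨j, fun hj => hi (hj ▸ hz), rfl⟩

/-- Well-order a dense set in type `ω₁` and keep in `I` the points outside the closed span of their
predecessors. Supports include the predecessors, so a support-closed `B ⊆ I` missing some `d ∈ I`
lies entirely below `d`, and its closed span misses `d`. -/
theorem exists_isSupportSystem_of_dens_eq (h : dens E = Cardinal.aleph 1) :
    ∃ I q, IsSupportSystem (E := E) I q := by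
  obtain ⟨D, hD, hcard⟩ : dens E ∈ {κ | ∃ D : Set E, Dense D ∧ Cardinal.mk D = κ} :=
    csInf_mem ⟨_, univ, dense_univ, rfl⟩
  rw [h] at hcard
  obtain ⟨r, hwo, hr⟩ := Cardinal.exists_ord_eq D
  have hpred (d : D) : {e | r e d}.Countable := by
    have h1 := Ordinal.typein_lt_type r d
    rw [← hr, Cardinal.lt_ord, Ordinal.card_typein, hcard, ← Cardinal.succ_aleph0,
      Order.lt_succ_iff] at h1
    exact Cardinal.mk_le_aleph0_iff.1 h1
  let below : D → Set E := fun d => Subtype.val '' {e | r e d}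
  let I : Set E := Subtype.val '' {d : D | (d : E) ∉ (span ℝ (below d)).topologicalClosure}
  -- A discarded point lies in the closed span of its predecessors, so well-founded induction
  -- applies.
  have hDI (d : D) : (d : E) ∈ (span ℝ I).topologicalClosure := by
    induction d using hwo.wf.induction with
    | _ d ih =>
      by_cases hd : (d : E) ∈ (span ℝ (below d)).topologicalClosure
      · refine topologicalClosure_minimal _ (span_le.2 ?_) (isClosed_topologicalClosure _) hd
        rintro _ ⟨e, he, rfl⟩
        exact ih e he
      · exact le_topologicalClosure _ (subset_span ⟨d, hd, rfl⟩)
  have hI (y : E) : y ∈ (span ℝ I).topologicalClosure :=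
    closure_minimal (fun d hd => hDI ⟨d, hd⟩) (isClosed_topologicalClosure _) (hD y)
  choose S hSI hSc hS using fun y => exists_countable_mem_topologicalClosure_span (hI y)
  refine ⟨I, fun y => S y ∪ {z | ∃ d e : D, (d : E) = y ∧ (e : E) = z ∧ r e d}, fun y => ?_,
    fun y => ?_, fun A hA B hB _ hBq hAB y hy => ?_⟩
  · refine (hSc y).union ?_
    by_cases hy : y ∈ D
    · refine ((hpred ⟨y, hy⟩).image Subtype.val).mono ?_
      rintro z ⟨d, e, rfl, rfl, hed⟩
      exact ⟨e, hed, rfl⟩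
    · convert countable_empty
      refine eq_empty_of_forall_notMem ?_
      rintro z ⟨d, e, rfl, -⟩
      exact hy d.2
  · exact topologicalClosure_mono (span_mono (subset_inter subset_union_left (hSI y))) (hS y)
  · have hyI := hA hy
    obtain ⟨d, hd, rfl⟩ := hyI
    by_contra hdB
    refine hd (topologicalClosure_mono (span_mono fun z hz => ?_)
      (hAB (le_topologicalClosure _ (subset_span hy))))
    obtain ⟨e, -, rfl⟩ := hB hz
    rcases trichotomous_of r e d with hed | rfl | hde
    · exact ⟨e, hed, rfl⟩
    · exact absurd hz hdB
    · exact absurd (hBq e hz ⟨.inr ⟨e, d, rfl, rfl, hde⟩, hA hy⟩) hdB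

end Support

/-! ### Models adapted to the space -/

section Models

variable {X : ZFSet.{u}} [NormedAddCommGroup X] [NormedSpace ℝ X]

/-- The elements of `I` that belong to the set of sets `M`. -/
def trace (I : Set X) (M : Set ZFSet.{u}) : Set X := {x | x ∈ I ∧ (x : ZFSet.{u}) ∈ M}

/-- A set of sets that is rich enough to be a suitable model adapted to the space `X`. -/
structure IsAdapted (Y : ZFSet.{u}) (q : X → Set X) (M : Set ZFSet.{u}) : Prop where
  subset : (Y : Set ZFSet.{u}) ⊆ M
  skolem : ∀ s : Finset ZFSet.{u}, (s : Set ZFSet.{u}) ⊆ M → skolemValues s ⊆ M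
  support : ∀ x : X, (x : ZFSet.{u}) ∈ M → ∀ y ∈ q x, (y : ZFSet.{u}) ∈ M
  span : ∀ s : Set X, s.Finite → (∀ x ∈ s, (x : ZFSet.{u}) ∈ M) →
    (span ℝ s : Set X) ⊆ closure {x : X | (x : ZFSet.{u}) ∈ M}

theorem exists_operation {Y : ZFSet.{u}} (hY : (Y : Set ZFSet.{u}).Countable) {q : X → Set X}
    (hq : ∀ x, (q x).Countable) :
    ∃ G : Finset ZFSet.{u} → Set ZFSet.{u}, (∀ s, (G s).Countable) ∧
      ∀ M, IsClosedUnder G M → IsAdapted Y q M := by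
  have hfin (s : Finset ZFSet.{u}) : {x : X | (x : ZFSet.{u}) ∈ s}.Finite :=
    s.finite_toSet.preimage Subtype.val_injective.injOn
  choose c hcc hc using fun s => (hfin s).countable.isSeparable.span (R := ℝ)
  refine ⟨fun s => Y ∪ skolemValues s ∪
    Subtype.val '' (c s ∪ ⋃ x ∈ {x : X | (x : ZFSet.{u}) ∈ s}, q x), fun s => ?_, fun M hM => ?_⟩
  · exact (hY.union (countable_skolemValues s)).union
      (((hcc s).union ((hfin s).countable.biUnion fun x _ => hq x)).image _)
  · refine ⟨?_, fun s hs => ?_, fun x hx y hy => ?_, fun s hs hsM => ?_⟩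
    · exact fun y hy => hM ∅ (by simp) (.inl (.inl hy))
    · exact fun y hy => hM s hs (.inl (.inr hy))
    · refine hM {(x : ZFSet.{u})} (by simpa using hx) (.inr ⟨y, .inr ?_, rfl⟩)
      exact mem_biUnion (x := x) (by simp) hy
    · lift s to Finset X using hs
      classical
      let t : Finset ZFSet.{u} := s.image Subtype.val
      have ht : {x : X | (x : ZFSet.{u}) ∈ t} = s := by
        ext x
        simp [t]
      have htM : (t : Set ZFSet.{u}) ⊆ M := by
        intro y hy
        obtain ⟨x, hx, rfl⟩ := Finset.mem_image.1 hy
        exact hsM x hx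
      have := hc t
      rw [ht] at this
      exact this.trans (closure_mono fun y hy => hM t htM (.inr ⟨y, .inl hy, rfl⟩))

theorem IsAdapted.closure_eq {Y : ZFSet.{u}} {I : Set X} {q : X → Set X} {M : Set ZFSet.{u}}
    (hM : IsAdapted Y q M) (hq : IsSupportSystem I q) :
    closure {x : X | (x : ZFSet.{u}) ∈ M} = (Submodule.span ℝ (trace I M)).topologicalClosure := by
  refine Subset.antisymm (closure_minimal (fun x hx => ?_) (isClosed_topologicalClosure _))
    (closure_minimal (fun x hx => ?_) isClosed_closure)
  · exact topologicalClosure_mono (span_mono fun y hy => And.intro hy.2 (hM.support x hx y hy.1))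
      (hq.mem x)
  · obtain ⟨T, hT, hxT⟩ := mem_span_finite_of_mem_span hx
    exact hM.span T T.finite_toSet (fun y hy => (hT hy).2) hxT

theorem IsSupportSystem.suitableModelsGenerateNiceRichFamilies {I : Set X} {q : X → Set X}
    (hq : IsSupportSystem I q) : SuitableModelsGenerateNiceRichFamilies X := by
  intro Y Φ hY
  obtain ⟨G, hG, hGM⟩ := exists_operation hY hq.countable
  let H : Set X → Set ZFSet.{u} := fun A => hull G (Subtype.val '' A)
  have hH (A : Set X) : IsAdapted Y q (H A) := hGM _ (isClosedUnder_hull G _)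
  have hHmono : Monotone H := fun A B h => hull_mono (image_mono h)
  have hHc {A : Set X} (hA : A.Countable) : (H A).Countable := countable_hull hG (hA.image _)
  have hAH (A : Set X) {x : X} (hx : x ∈ A) : (x : ZFSet.{u}) ∈ H A :=
    subset_hull G _ ⟨x, hx, rfl⟩
  let P : Set (Set X) := {A | A.Countable ∧ A ⊆ I ∧ trace I (H A) = A}
  have hPtrace {A : Set X} (hA : A ∈ P) : ∀ x ∈ A, q x ∩ I ⊆ A := by
    intro x hx y hy
    rw [← hA.2.2]
    exact ⟨hy.2, (hH A).support x (hAH A hx) y hy.1⟩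
  have hcl {A : Set X} (hA : A ∈ P) : closure {x : X | (x : ZFSet.{u}) ∈ H A} =
      (span ℝ A).topologicalClosure := by
    rw [(hH A).closure_eq hq, hA.2.2]
  have hPle {A B : Set X} (hA : A ∈ P) (hB : B ∈ P)
      (h : closure {x : X | (x : ZFSet.{u}) ∈ H A} ⊆ closure {x : X | (x : ZFSet.{u}) ∈ H B}) :
      A ⊆ B := by
    rw [hcl hA, hcl hB] at h
    exact hq.subset_of_le A hA.2.1 B hB.2.1 (hPtrace hA) (hPtrace hB) h
  have hsmall (A : P) : Small.{u} (H A) :=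
    have := (hHc A.2.1).to_subtype
    inferInstance
  let mdl : P → ZFSet.{u} := fun A => ZFSet.range (Subtype.val : H A → ZFSet.{u})
  have hmdl (A : P) {x : ZFSet.{u}} : x ∈ mdl A ↔ x ∈ H A := by simp [mdl]
  have hcoe (A : P) : (mdl A : Set ZFSet.{u}) = H A := by
    ext x
    exact hmdl A
  have hmcl (A : P) : closureInter X (mdl A) = closure {x : X | (x : ZFSet.{u}) ∈ H A} := by
    simp only [closureInter, hmdl]
  refine ⟨ZFSet.range mdl, ?_, ⟨?_, ?_, ?_, ?_, ?_⟩, ?_⟩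
  · intro M hM
    obtain ⟨A, rfl⟩ := ZFSet.mem_range.1 hM
    refine ⟨fun y hy => (hmdl A).2 ((hH A).subset hy), ?_, fun φ _ a ha => ?_⟩
    · rw [hcoe]
      exact hHc A.2.1
    · have hN (s : Finset ZFSet.{u}) (hs : (s : Set ZFSet.{u}) ⊆ mdl A) :
          skolemValues s ⊆ mdl A := by
        rw [hcoe] at hs ⊢
        exact (hH A).skolem s hs
      convert realizeRel_iff_realize hN φ a ha default (fun j => j.elim0) using 1
      rw [FirstOrder.Language.Formula.Realize]
      congr!
  · rintro _ ⟨M, hM, rfl⟩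
    obtain ⟨A, rfl⟩ := ZFSet.mem_range.1 hM
    exact ⟨_, (hcl A.2).symm.trans (hmcl A).symm⟩
  · rintro _ ⟨M, -, rfl⟩
    exact isClosed_closure
  · rintro _ ⟨M, hM, rfl⟩
    obtain ⟨A, rfl⟩ := ZFSet.mem_range.1 hM
    rw [hmcl, hcl A.2]
    exact A.2.1.isSeparable.span.closure
  · intro W hW
    obtain ⟨D, hDc, hD⟩ := hW
    let A₀ : Set X := ⋃ d ∈ D, q d ∩ I
    have hA₀ : A₀.Countable := hDc.biUnion fun d _ => (hq.countable d).mono inter_subset_left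
    have hA₀I : A₀ ⊆ I := iUnion₂_subset fun d _ => inter_subset_right
    -- Enlarging `A₀` to its trace leaves the hull unchanged, so `A` satisfies the fixed-point
    -- condition in `P`.
    let A : Set X := trace I (H A₀)
    have hA₀A : A₀ ⊆ A := fun x hx => ⟨hA₀I hx, hAH A₀ hx⟩
    have hHA : H A = H A₀ := by
      refine Subset.antisymm (hull_subset ?_ (isClosedUnder_hull G _)) (hHmono hA₀A)
      rintro _ ⟨x, hx, rfl⟩
      exact hx.2
    have hA : A ∈ P := by
      refine ⟨?_, fun x hx => hx.1, by rw [hHA]⟩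
      exact ((hHc hA₀).preimage Subtype.val_injective).mono fun x hx => hx.2
    refine ⟨_, ⟨mdl ⟨A, hA⟩, ZFSet.mem_range.2 ⟨_, rfl⟩, rfl⟩, ?_⟩
    rw [hmcl, hcl hA]
    refine hD.trans (closure_minimal (fun d hd => ?_) (isClosed_topologicalClosure _))
    exact topologicalClosure_mono
      (span_mono ((subset_biUnion_of_mem (u := fun d => q d ∩ I) hd).trans hA₀A)) (hq.mem d)
  · intro S hS hSmono
    have hS' (n : ℕ) : ∃ A : P, closure {x : X | (x : ZFSet.{u}) ∈ H A} = S n := by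
      obtain ⟨M, hM, hMS⟩ := hS n
      obtain ⟨A, rfl⟩ := ZFSet.mem_range.1 hM
      exact ⟨A, (hmcl A).symm.trans hMS⟩
    choose A hA using hS'
    -- Recovering index sets from closed spans turns increasing spaces into increasing index sets,
    -- as `hull_iUnion` requires.
    have hAmono : Monotone fun n => (A n : Set X) := fun m n h =>
      hPle (A m).2 (A n).2 (by rw [hA, hA]; exact hSmono h)
    have hHU : H (⋃ n, (A n : Set X)) = ⋃ n, H (A n) := by
      simp only [H, image_iUnion]
      exact hull_iUnion fun m n h => image_mono (hAmono h)
    have hU : (⋃ n, (A n : Set X)) ∈ P := by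
      refine ⟨countable_iUnion fun n => (A n).2.1, iUnion_subset fun n => (A n).2.2.1, ?_⟩
      rw [hHU]
      refine Subset.antisymm (fun x hx => ?_) (iUnion_subset fun n x hx => ?_)
      · obtain ⟨n, hn⟩ := mem_iUnion.1 hx.2
        refine mem_iUnion.2 ⟨n, ?_⟩
        rw [← (A n).2.2.2]
        exact ⟨hx.1, hn⟩
      · exact ⟨(A n).2.2.1 hx, mem_iUnion.2 ⟨n, hAH _ hx⟩⟩
    refine ⟨mdl ⟨_, hU⟩, ZFSet.mem_range.2 ⟨_, rfl⟩, ?_⟩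
    rw [hmcl]
    refine Subset.antisymm (closure_mono fun x hx => ?_)
      (closure_minimal (iUnion_subset fun n => ?_) isClosed_closure)
    · obtain ⟨n, hn⟩ := mem_iUnion.1 (hHU ▸ hx : (x : ZFSet.{u}) ∈ ⋃ n, H (A n))
      exact mem_iUnion.2 ⟨n, hA n ▸ subset_closure hn⟩
    · rw [← hA n]
      exact closure_mono fun x hx => hHmono (subset_iUnion (fun n => (A n : Set X)) n) hx
  · intro M hM N hN
    obtain ⟨A, rfl⟩ := ZFSet.mem_range.1 hM
    obtain ⟨B, rfl⟩ := ZFSet.mem_range.1 hN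
    refine ⟨fun h => closure_mono fun x hx => h hx, fun h x hx => ?_⟩
    rw [hmcl, hmcl] at h
    exact (hmdl B).2 (hHmono (hPle A.2 B.2 h) ((hmdl A).1 hx))

end Models

end SetModels

theorem mainTheorem2 (X : ZFSet.{u}) [NormedAddCommGroup X] [NormedSpace ℝ X] [CompleteSpace X]
    (hX : (∃ (ι : Type v) (x : ι → X), SetModels.IsFundamentalMinimalSystem x) ∨
      SetModels.dens X = Cardinal.aleph 1) :
    SetModels.SuitableModelsGenerateNiceRichFamilies X := by
  obtain ⟨I, q, hq⟩ : ∃ I q, SetModels.IsSupportSystem (E := X) I q := by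
    rcases hX with ⟨ι, x, hx⟩ | h
    · exact hx.exists_isSupportSystem
    · exact SetModels.exists_isSupportSystem_of_dens_eq h
  exact hq.suitableModelsGenerateNiceRichFamilies
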